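/- Let $A,F,Q\in\mathbb R^{n\times n}$ with $F$ and $Q$ symmetric positive definite, and let $F=LL^\top$ (for instance the Cholesky factorization). Let $\mathcal R(X)=A^\top X+XA-XFX+Q$, and assume that the numerical range $\mathcal W(L^{-1}AL)=\{x^HL^{-1}ALx:\ x\in\mathbb C^n,\ \|x\|_2=1\}$ is contained in $\{\Re z<0\}$. A real matrix is called stable if all its eigenvalues have negative real part; a stabilizing solution of the CARE $\mathcal R(X)=0$ is a solution $X$ for which $A-FX$ is stable. For an integer $s\ge 0$, let $\mathcal T_s(M)$ be the matrix obtained from $M$ by replacing the entries with $|i-j|>s$ by $0$. Let $\widetilde X_0$ be symmetric positive semidefinite with $A-F\widetilde X_0$ stable. Let $\{\widetilde X_k\}_{k\ge0}$ be generated from $\widetilde X_0$ by the truncated inexact Newton-Kleinman iteration (TINK), run without stopping test. In step $k$, put $\widetilde A_{cl,k}=A-F\widetilde X_k$: 1. $\widehat X_{k+1}$ is the result of $it_k\ge 0$ steps of GMRES with zero initial guess, applied to the (vectorized) Lyapunov equation $\widetilde A_{cl,k}^\top X+X\widetilde A_{cl,k}=-(\widetilde X_kF\widetilde X_k+Q)$;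 2. if line search is used, $\lambda_k\in(0,1)$ satisfies $\|\mathcal R((1-\lambda_k)\widetilde X_k+\lambda_k\widehat X_{k+1})\|_2\le(1-\lambda_k\alpha)\|\mathcal R(\widetilde X_k)\|_2$, with a fixed $\alpha>0$; otherwise $\lambda_k=1$; 3. $\widetilde X_{k+1}=\mathcal T_{s_k}\big((1-\lambda_k)\widetilde X_k+\lambda_k\widehat X_{k+1}\big)$ with an integer $s_k\ge 0$. The numbers $it_k$ may be arbitrary. Assume that there is $\overline\lambda>0$ with $\lambda_k\ge\overline\lambda$ for all $k$, and that there is $\zeta\in(0,1)$ such that for all $k\ge 0$ $$\|\mathcal R(\widetilde X_{k+1})\|_2\le(1-\zeta)\,\|\mathcal R(\widetilde X_k)\|_2,$$ $$\|\widetilde A_{cl,k}^\top\widetilde X_{k+1}+\widetilde X_{k+1}\widetilde A_{cl,k}+\widetilde X_kF\widetilde X_k+Q\|_2\le\lambda_{\min}(Q).$$ Then the CARE $\mathcal R(X)=0$ has a unique stabilizing solution $X^*$, it is symmetric positive definite, and $\widetilde X_k\to X^*$ as $k\to\infty$. -/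

import Mathlib

open Filter Topology Matrix
open scoped Kronecker

namespace TINK

/-- The numerical range `{xᴴ M x : x ∈ ℂⁿ, ‖x‖₂ = 1}` of a real square matrix. -/
def numericalRange {n : ℕ} (M : Matrix (Fin n) (Fin n) ℝ) : Set ℂ :=
  {z | ∃ x : EuclideanSpace ℂ (Fin n), ‖x‖ = 1 ∧
    z = star x.ofLp ⬝ᵥ (M.map Complex.ofReal *ᵥ x.ofLp)}

/-- A real square matrix is stable if its complex eigenvalues lie in the open left half-plane. -/
def IsStable {n : ℕ} (M : Matrix (Fin n) (Fin n) ℝ) : Prop :=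
  ∀ μ ∈ spectrum ℂ (M.map Complex.ofReal), μ.re < 0

/-- The smallest eigenvalue of a real symmetric matrix (of positive size). -/
noncomputable def lambdaMin {n : ℕ} (M : Matrix (Fin n) (Fin n) ℝ) : ℝ :=
  sInf (spectrum ℝ M)

/-- The spectral norm `‖M‖₂`, the operator norm induced by the Euclidean norm. -/
noncomputable def norm2 {n : ℕ} (M : Matrix (Fin n) (Fin n) ℝ) : ℝ :=
  ‖Matrix.toEuclideanCLM (n := Fin n) (𝕜 := ℝ) M‖

/-- The Riccati operator `R(X) = Aᵀ X + X A - X F X + Q`. -/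
def riccati {n : ℕ} (A F Q X : Matrix (Fin n) (Fin n) ℝ) : Matrix (Fin n) (Fin n) ℝ :=
  Aᵀ * X + X * A - X * F * X + Q

/-- The closed-loop matrix `A - F X`. -/
def closedLoop {n : ℕ} (A F X : Matrix (Fin n) (Fin n) ℝ) : Matrix (Fin n) (Fin n) ℝ :=
  A - F * X

/-- `X` solves the continuous-time algebraic Riccati equation `R(X) = 0` and is stabilizing. -/
def IsStabilizingSolution {n : ℕ} (A F Q X : Matrix (Fin n) (Fin n) ℝ) : Prop :=
  riccati A F Q X = 0 ∧ IsStable (closedLoop A F X)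

/-- The residual of `Y` in the Lyapunov equation for the Newton step at `X`:
`(A - F X)ᵀ Y + Y (A - F X) + X F X + Q`. -/
def lyapunovResidual {n : ℕ} (A F Q X Y : Matrix (Fin n) (Fin n) ℝ) :
    Matrix (Fin n) (Fin n) ℝ :=
  (closedLoop A F X)ᵀ * Y + Y * closedLoop A F X + X * F * X + Q

/-- The `n² × n²` matrix of the Lyapunov operator `Y ↦ Cᵀ Y + Y C`, for the vectorization `vec`
that stacks the columns. -/
def lyapunovMatrix {n : ℕ} (C : Matrix (Fin n) (Fin n) ℝ) :
    Matrix (Fin n × Fin n) (Fin n × Fin n) ℝ :=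
  (1 : Matrix (Fin n) (Fin n) ℝ) ⊗ₖ Cᵀ + Cᵀ ⊗ₖ (1 : Matrix (Fin n) (Fin n) ℝ)

theorem lyapunovMatrix_mulVec_vec {n : ℕ} (C Y : Matrix (Fin n) (Fin n) ℝ) :
    lyapunovMatrix C *ᵥ vec Y = vec (Cᵀ * Y + Y * C) := by
  simp [lyapunovMatrix, Matrix.add_mulVec, Matrix.kronecker_mulVec_vec]

/-- The Krylov subspace spanned by `b, M b, …, M^(m-1) b`. -/
def krylov {ι : Type*} [Fintype ι] [DecidableEq ι] (M : Matrix ι ι ℝ) (b : ι → ℝ) (m : ℕ) :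
    Submodule ℝ (ι → ℝ) :=
  Submodule.span ℝ (Set.range fun j : Fin m => (M ^ (j : ℕ)) *ᵥ b)

/-- `x` is the result of `m` steps of GMRES on `M x = b` with zero initial guess: it minimizes
the Euclidean norm of the residual over the `m`-th Krylov subspace. -/
def IsGMRESIterate {ι : Type*} [Fintype ι] [DecidableEq ι] (M : Matrix ι ι ℝ) (b : ι → ℝ)
    (m : ℕ) (x : ι → ℝ) : Prop :=
  x ∈ krylov M b m ∧ ∀ y ∈ krylov M b m,
    ‖WithLp.toLp 2 (b - M *ᵥ x)‖ ≤ ‖WithLp.toLp 2 (b - M *ᵥ y)‖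

/-- The banded truncation: entries with `|i - j| ≤ s` are kept, the others are set to zero. -/
def bandTruncation {n : ℕ} (s : ℕ) (M : Matrix (Fin n) (Fin n) ℝ) :
    Matrix (Fin n) (Fin n) ℝ :=
  Matrix.of fun i j => if |((i : ℕ) : ℤ) - ((j : ℕ) : ℤ)| ≤ (s : ℤ) then M i j else 0

/-- An infinite run of the truncated inexact Newton-Kleinman iteration (no stopping test) with
iterates `X k`, where `it k` is the number of GMRES steps, `Xhat (k + 1)` the GMRES result,
`lam k` the step length and `s k` the truncation parameter in step `k`. If `linesearch` is
`true`, every `lam k` satisfies the line search condition with parameter `α`; otherwise it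
is `1`. The conditions by which the `s k` are selected are not part of this predicate. -/
structure IsRun {n : ℕ} (A F Q X₀ : Matrix (Fin n) (Fin n) ℝ) (linesearch : Bool) (α : ℝ)
    (it s : ℕ → ℕ) (lam : ℕ → ℝ) (Xhat X : ℕ → Matrix (Fin n) (Fin n) ℝ) : Prop where
  init : X 0 = X₀
  gmres : ∀ k, IsGMRESIterate (lyapunovMatrix (closedLoop A F (X k)))
    (-vec (X k * F * X k + Q)) (it k) (vec (Xhat (k + 1)))
  search : linesearch = true → ∀ k, 0 < lam k ∧ lam k < 1 ∧
    norm2 (riccati A F Q ((1 - lam k) • X k + lam k • Xhat (k + 1))) ≤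
      (1 - lam k * α) * norm2 (riccati A F Q (X k))
  noSearch : linesearch = false → ∀ k, lam k = 1
  update : ∀ k, X (k + 1) = bandTruncation (s k) ((1 - lam k) • X k + lam k • Xhat (k + 1))

end TINK

/-! Conjugation by L turns the closed loop A - FX into B - LᵀXL with B = L⁻¹AL. The numerical range
hypothesis makes the real quadratic form of B negative definite, and subtracting a positive
semidefinite matrix preserves this. So A - FX is stable for every positive semidefinite X
(`dissipative_conj_closedLoop`, `isStable_conj`).

All iterates are positive semidefinite (`IsRun.posSemidef`): the Krylov spaces and the truncation
preserve symmetry, and a Lyapunov residual of norm at most λ_min(Q) is absorbed by Q, which leaves a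
negative semidefinite right-hand side.

The residuals R(X_k) decay geometrically, and a trace estimate (`sq_apply_le_trace`) bounds a
positive semidefinite X by R(X), so the iterates stay in a compact set. Each cluster point is a
positive semidefinite, hence stabilizing, solution. Stabilizing solutions coincide by a Sylvester
argument, so there is only one cluster point and the sequence converges; existence is a by-product.
-/

namespace TINK

/-! ### Dissipativity and stability -/

/-- The quadratic form of `M` is negative definite. -/
def Dissipative {n : ℕ} (M : Matrix (Fin n) (Fin n) ℝ) : Prop :=
  ∀ x : Fin n → ℝ, x ≠ 0 → x ⬝ᵥ M *ᵥ x < 0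

theorem dissipative_of_numericalRange {n : ℕ} {M : Matrix (Fin n) (Fin n) ℝ}
    (h : ∀ z ∈ numericalRange M, z.re < 0) : Dissipative M := by
  intro x hx
  have hpos : 0 < ‖(WithLp.toLp 2 x : EuclideanSpace ℝ (Fin n))‖ := by
    rw [norm_pos_iff]
    intro h0
    exact hx (by simpa using congrArg WithLp.ofLp h0)
  set r := ‖(WithLp.toLp 2 x : EuclideanSpace ℝ (Fin n))‖ with hr
  set y : Fin n → ℝ := r⁻¹ • x with hy
  have hyn : ‖(WithLp.toLp 2 (fun i => (y i : ℂ)) : EuclideanSpace ℂ (Fin n))‖ = 1 := by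
    have h1 : ‖(WithLp.toLp 2 (fun i => (y i : ℂ)) : EuclideanSpace ℂ (Fin n))‖ =
        ‖(WithLp.toLp 2 y : EuclideanSpace ℝ (Fin n))‖ := by
      simp [EuclideanSpace.norm_eq]
    rw [h1, hy, WithLp.toLp_smul, norm_smul, ← hr, norm_inv, Real.norm_of_nonneg hpos.le]
    exact inv_mul_cancel₀ hpos.ne'
  have h2 := h _ ⟨_, hyn, rfl⟩
  have h3 : star (fun i => (y i : ℂ)) ⬝ᵥ (M.map Complex.ofReal *ᵥ (fun i => (y i : ℂ))) =
      ((y ⬝ᵥ M *ᵥ y : ℝ) : ℂ) := by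
    simp [dotProduct, mulVec]
  rw [h3, Complex.ofReal_re, hy, mulVec_smul, smul_dotProduct, dotProduct_smul, smul_eq_mul,
    smul_eq_mul, ← mul_assoc] at h2
  have h4 : 0 < r⁻¹ * r⁻¹ := by positivity
  exact neg_of_mul_neg_right h2 h4.le

theorem exists_mulVec_eq_smul {n : ℕ} {M : Matrix (Fin n) (Fin n) ℂ} {μ : ℂ}
    (hμ : μ ∈ spectrum ℂ M) : ∃ w : Fin n → ℂ, w ≠ 0 ∧ M *ᵥ w = μ • w := by
  rw [spectrum.mem_iff, Matrix.isUnit_iff_isUnit_det, isUnit_iff_ne_zero, not_not] at hμ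
  obtain ⟨w, hw, h⟩ := Matrix.exists_mulVec_eq_zero_iff.mpr hμ
  refine ⟨w, hw, ?_⟩
  rw [sub_mulVec, sub_eq_zero, Algebra.algebraMap_eq_smul_one, smul_mulVec, one_mulVec] at h
  exact h.symm

/-- For an eigenvector u + iv with eigenvalue μ, the cross terms cancel in uᵀMu + vᵀMv = Re μ (|u|²
+ |v|²). -/
theorem Dissipative.isStable {n : ℕ} {M : Matrix (Fin n) (Fin n) ℝ} (h : Dissipative M) :
    IsStable M := by
  intro μ hμ
  obtain ⟨w, hw, hM⟩ := exists_mulVec_eq_smul hμ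
  set u : Fin n → ℝ := fun i => (w i).re with hu
  set v : Fin n → ℝ := fun i => (w i).im with hv
  have hMu : M *ᵥ u = μ.re • u - μ.im • v := by
    ext i
    have := congrArg Complex.re (congrFun hM i)
    simpa [mulVec, dotProduct, hu, hv] using this
  have hMv : M *ᵥ v = μ.re • v + μ.im • u := by
    ext i
    have := congrArg Complex.im (congrFun hM i)
    simpa [mulVec, dotProduct, hu, hv] using this
  have hle : ∀ x : Fin n → ℝ, x ⬝ᵥ M *ᵥ x ≤ 0 := by
    intro x
    by_cases hx : x = 0
    · simp [hx]
    · exact (h x hx).le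
  have hsum : u ⬝ᵥ M *ᵥ u + v ⬝ᵥ M *ᵥ v = μ.re * (u ⬝ᵥ u + v ⬝ᵥ v) := by
    rw [hMu, hMv]
    simp only [dotProduct_sub, dotProduct_add, dotProduct_smul, smul_eq_mul, dotProduct_comm v u]
    ring
  have hneg : u ⬝ᵥ M *ᵥ u + v ⬝ᵥ M *ᵥ v < 0 := by
    by_cases h0 : u = 0
    · have : v ≠ 0 := by
        intro h1
        apply hw
        ext i
        exact Complex.ext (congrFun h0 i) (congrFun h1 i)
      linarith [hle u, h v this]
    · linarith [hle v, h u h0]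
  have hnn : 0 ≤ u ⬝ᵥ u + v ⬝ᵥ v :=
    add_nonneg (Finset.sum_nonneg fun i _ => mul_self_nonneg _)
      (Finset.sum_nonneg fun i _ => mul_self_nonneg _)
  rw [hsum] at hneg
  exact neg_of_mul_neg_left hneg hnn

theorem map_ofReal_mul {n : ℕ} (M N : Matrix (Fin n) (Fin n) ℝ) :
    (M * N).map Complex.ofReal = M.map Complex.ofReal * N.map Complex.ofReal :=
  Matrix.map_mul (f := Complex.ofRealHom)

theorem isStable_conj {n : ℕ} {L M : Matrix (Fin n) (Fin n) ℝ} (hL : IsUnit L.det)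
    (h : IsStable (L⁻¹ * M * L)) : IsStable M := by
  intro μ hμ
  apply h
  obtain ⟨w, hw, hM⟩ := exists_mulVec_eq_smul hμ
  have hLL : L⁻¹.map Complex.ofReal * L.map Complex.ofReal = 1 := by
    rw [← map_ofReal_mul, nonsing_inv_mul _ hL]
    simp
  have hLL' : L.map Complex.ofReal * L⁻¹.map Complex.ofReal = 1 := mul_eq_one_comm.mp hLL
  have key : (L⁻¹ * M * L).map Complex.ofReal *ᵥ (L⁻¹.map Complex.ofReal *ᵥ w) =
      μ • (L⁻¹.map Complex.ofReal *ᵥ w) := by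
    rw [map_ofReal_mul, map_ofReal_mul, mulVec_mulVec, Matrix.mul_assoc, hLL', Matrix.mul_one,
      ← mulVec_mulVec, hM, mulVec_smul]
  rw [spectrum.mem_iff, Matrix.isUnit_iff_isUnit_det, isUnit_iff_ne_zero, not_not,
    ← Matrix.exists_mulVec_eq_zero_iff]
  refine ⟨L⁻¹.map Complex.ofReal *ᵥ w, fun h0 => hw ?_, ?_⟩
  · have := congrArg (fun z => L.map Complex.ofReal *ᵥ z) h0
    simpa [mulVec_mulVec, hLL'] using this
  · rw [sub_mulVec, key, Algebra.algebraMap_eq_smul_one, smul_mulVec, one_mulVec, sub_self]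

theorem Dissipative.sub_posSemidef {n : ℕ} {B Y : Matrix (Fin n) (Fin n) ℝ}
    (hB : Dissipative B) (hY : Y.PosSemidef) : Dissipative (B - Y) := by
  intro x hx
  have := hY.dotProduct_mulVec_nonneg x
  rw [star_trivial] at this
  rw [sub_mulVec, dotProduct_sub]
  linarith [hB x hx]

/-! ### Lyapunov and Sylvester equations -/

/-- A symmetric solution of a Lyapunov equation with dissipative coefficient and negative
semidefinite right-hand side is positive semidefinite. -/
theorem Dissipative.posSemidef_of_lyapunov {n : ℕ} {C Y P : Matrix (Fin n) (Fin n) ℝ}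
    (hC : Dissipative C) (hY : Y.IsHermitian) (hP : P.PosSemidef)
    (h : Cᵀ * Y + Y * C = -P) : Y.PosSemidef := by
  rw [hY.posSemidef_iff_eigenvalues_nonneg]
  intro i
  set v : Fin n → ℝ := (hY.eigenvectorBasis i).ofLp with hv
  have hv0 : v ≠ 0 := by
    intro h0
    have h1 := hY.eigenvectorBasis.orthonormal.ne_zero i
    exact h1 (by ext j; exact congrFun h0 j)
  have hYv : Y *ᵥ v = hY.eigenvalues i • v := hY.mulVec_eigenvectorBasis i
  have hYt : v ᵥ* Y = hY.eigenvalues i • v := by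
    have hYs : Yᵀ = Y := by simpa using hY.eq
    rw [← mulVec_transpose, hYs, hYv]
  -- Testing with an eigenvector v of Y for the eigenvalue t gives 2t vᵀCv = -vᵀPv ≤ 0, which forces
  -- t ≥ 0.
  have h2 := congrArg (fun Z => v ⬝ᵥ Z *ᵥ v) h
  have h3 : v ⬝ᵥ (Cᵀ * Y) *ᵥ v = hY.eigenvalues i * (v ⬝ᵥ C *ᵥ v) := by
    rw [← mulVec_mulVec, hYv, mulVec_smul, dotProduct_smul, smul_eq_mul, mulVec_transpose,
      dotProduct_comm, ← dotProduct_mulVec]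
  have h4 : v ⬝ᵥ (Y * C) *ᵥ v = hY.eigenvalues i * (v ⬝ᵥ C *ᵥ v) := by
    rw [← mulVec_mulVec, dotProduct_mulVec, hYt, smul_dotProduct, smul_eq_mul]
  have h5 := hP.dotProduct_mulVec_nonneg v
  rw [star_trivial] at h5
  simp only [add_mulVec, dotProduct_add, neg_mulVec, dotProduct_neg] at h2
  rw [h3, h4] at h2
  by_contra hneg
  have := mul_pos_of_neg_of_neg (not_le.mp hneg) (hC v hv0)
  linarith

/-- Uniqueness for the Sylvester equation `S D + D T = 0` with stable coefficients. -/
theorem eq_zero_of_sylvester {n : ℕ} {S T D : Matrix (Fin n) (Fin n) ℝ}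
    (hS : IsStable S) (hT : IsStable T) (h : S * D + D * T = 0) : D = 0 := by
  set S' := S.map Complex.ofReal
  set T' := T.map Complex.ofReal
  set D' := D.map Complex.ofReal with hD'
  have h' : S' * D' = D' * (-T') := by
    have h1 : (S * D).map Complex.ofReal + (D * T).map Complex.ofReal = 0 := by
      rw [← Matrix.map_add _ Complex.ofReal_add, h]
      simp
    rw [map_ofReal_mul, map_ofReal_mul] at h1
    rw [mul_neg]
    exact eq_neg_of_add_eq_zero_left h1
  have hpoly : ∀ p : Polynomial ℂ, Polynomial.aeval S' p * D' = D' * Polynomial.aeval (-T') p := by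
    intro p
    induction p using Polynomial.induction_on' with
    | add p q hp hq => simp [add_mul, mul_add, hp, hq]
    | monomial k a =>
      have hk : S' ^ k * D' = D' * (-T') ^ k := by
        induction k with
        | zero => simp
        | succ k ih => rw [pow_succ, mul_assoc, h', ← mul_assoc, ih, mul_assoc, ← pow_succ]
      simp only [Polynomial.aeval_monomial, Algebra.algebraMap_eq_smul_one, smul_mul_assoc,
        one_mul, mul_smul_comm, hk]
  -- By Cayley-Hamilton the left side p(S)D vanishes for p the characteristic polynomial of S, while
  -- p(-T) is invertible: the spectra of S and -T lie in opposite half-planes.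
  have h0 := hpoly S'.charpoly
  rw [Matrix.aeval_self_charpoly, zero_mul] at h0
  have hu : IsUnit (Polynomial.aeval (-T') S'.charpoly) := by
    by_contra hcon
    rw [← spectrum.zero_mem_iff ℂ] at hcon
    rw [spectrum.map_polynomial_aeval_of_nonempty] at hcon
    · obtain ⟨μ, hμ, hroot⟩ := hcon
      have h1 := hS μ (Matrix.mem_spectrum_of_isRoot_charpoly hroot)
      rw [← spectrum.neg_eq] at hμ
      have h2 := hT (-μ) hμ
      simp at h2
      linarith
    -- The spectrum can be empty only for n = 0, where every matrix is a unit.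
    · by_contra hne
      rcases subsingleton_or_nontrivial (Matrix (Fin n) (Fin n) ℂ) with hs | hs
      · exact (spectrum.zero_mem_iff ℂ).mp hcon (isUnit_of_subsingleton _)
      · exact hne (spectrum.nonempty_of_isAlgClosed_of_finiteDimensional ℂ _)
  have hD0 : D' = 0 := (hu.mul_left_eq_zero).mp h0.symm
  ext i j
  have := congrFun (congrFun hD0 i) j
  simpa [hD'] using this

/-! ### Spectral norm estimates -/

theorem norm_mulVec_le {n : ℕ} (M : Matrix (Fin n) (Fin n) ℝ) (x : Fin n → ℝ) :
    ‖(WithLp.toLp 2 (M *ᵥ x) : EuclideanSpace ℝ (Fin n))‖ ≤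
      norm2 M * ‖(WithLp.toLp 2 x : EuclideanSpace ℝ (Fin n))‖ :=
  (Matrix.toEuclideanCLM (n := Fin n) (𝕜 := ℝ) M).le_opNorm (WithLp.toLp 2 x)

theorem dotProduct_mulVec_le_norm2 {n : ℕ} (M : Matrix (Fin n) (Fin n) ℝ) (x : Fin n → ℝ) :
    x ⬝ᵥ M *ᵥ x ≤ norm2 M * (x ⬝ᵥ x) := by
  have h1 := real_inner_le_norm (WithLp.toLp 2 (M *ᵥ x) : EuclideanSpace ℝ (Fin n))
    (WithLp.toLp 2 x)
  have h2 : x ⬝ᵥ x = ‖(WithLp.toLp 2 x : EuclideanSpace ℝ (Fin n))‖ ^ 2 := by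
    rw [← real_inner_self_eq_norm_sq, EuclideanSpace.inner_toLp_toLp, star_trivial]
  rw [EuclideanSpace.inner_toLp_toLp, star_trivial] at h1
  rw [h2, pow_two, ← mul_assoc]
  exact h1.trans (mul_le_mul_of_nonneg_right (norm_mulVec_le M x) (norm_nonneg _))

theorem abs_apply_le_norm2 {n : ℕ} (M : Matrix (Fin n) (Fin n) ℝ) (i j : Fin n) :
    |M i j| ≤ norm2 M := by
  have h1 := norm_mulVec_le M (Pi.single j 1)
  have h2 := PiLp.norm_apply_le (WithLp.toLp 2 (M *ᵥ Pi.single j 1) : EuclideanSpace ℝ (Fin n)) i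
  simp at h1 h2
  exact h2.trans h1

theorem posSemidef_sub_lambdaMin {n : ℕ} {Q : Matrix (Fin n) (Fin n) ℝ} (hQ : Q.IsHermitian) :
    (Q - lambdaMin Q • (1 : Matrix (Fin n) (Fin n) ℝ)).PosSemidef := by
  rw [Matrix.posSemidef_iff_isHermitian_and_spectrum_nonneg]
  refine ⟨hQ.sub (by simp [Matrix.IsHermitian]), ?_⟩
  intro t ht
  rw [← Algebra.algebraMap_eq_smul_one, ← spectrum.sub_singleton_eq] at ht
  obtain ⟨a, ha, b, hb, rfl⟩ := ht
  rw [Set.mem_singleton_iff] at hb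
  subst hb
  exact sub_nonneg.mpr (csInf_le (Matrix.finite_real_spectrum).bddBelow ha)

theorem posSemidef_sub_of_norm2_le {n : ℕ} {Q R : Matrix (Fin n) (Fin n) ℝ}
    (hQ : Q.IsHermitian) (hR : R.IsHermitian) (h : norm2 R ≤ lambdaMin Q) :
    (Q - R).PosSemidef := by
  refine .of_dotProduct_mulVec_nonneg (hQ.sub hR) fun x => ?_
  have h1 := (posSemidef_sub_lambdaMin hQ).dotProduct_mulVec_nonneg x
  have h2 := dotProduct_mulVec_le_norm2 R x
  have h3 : 0 ≤ x ⬝ᵥ x := Finset.sum_nonneg fun i _ => mul_self_nonneg _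
  simp only [star_trivial, sub_mulVec, dotProduct_sub, smul_mulVec, one_mulVec, dotProduct_smul,
    smul_eq_mul] at h1 ⊢
  nlinarith [mul_le_mul_of_nonneg_right h h3]

/-! ### Symmetry and positivity of the iterates -/

theorem isSymm_bandTruncation {n : ℕ} (s : ℕ) {M : Matrix (Fin n) (Fin n) ℝ} (hM : M.IsSymm) :
    (bandTruncation s M).IsSymm := by
  ext i j
  simp only [bandTruncation, Matrix.transpose_apply, Matrix.of_apply, hM.apply i j]
  rw [abs_sub_comm]

/-- The Lyapunov operator maps symmetric matrices to symmetric ones, so the whole Krylov space of a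
symmetric right-hand side is symmetric. -/
theorem isSymm_of_mem_krylov {n : ℕ} {C P Y : Matrix (Fin n) (Fin n) ℝ} (hP : P.IsSymm) {m : ℕ}
    (h : vec Y ∈ krylov (lyapunovMatrix C) (vec P) m) : Y.IsSymm := by
  have hpow : ∀ j : ℕ, ∃ Z : Matrix (Fin n) (Fin n) ℝ, Z.IsSymm ∧
      lyapunovMatrix C ^ j *ᵥ vec P = vec Z := by
    intro j
    induction j with
    | zero => exact ⟨P, hP, by simp⟩
    | succ j ih =>
      obtain ⟨Z, hZ, hj⟩ := ih
      refine ⟨Cᵀ * Z + Z * C, ?_, ?_⟩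
      · simp [Matrix.IsSymm, hZ.eq, add_comm]
      · rw [pow_succ', ← mulVec_mulVec, hj, lyapunovMatrix_mulVec_vec]
  have hspan : ∀ x ∈ krylov (lyapunovMatrix C) (vec P) m,
      ∃ Z : Matrix (Fin n) (Fin n) ℝ, Z.IsSymm ∧ x = vec Z := by
    intro x hx
    induction hx using Submodule.span_induction with
    | mem x hx =>
      obtain ⟨j, rfl⟩ := hx
      exact hpow j
    | zero => exact ⟨0, by simp [Matrix.IsSymm], by simp⟩
    | add x y _ _ hx hy =>
      obtain ⟨Z, hZ, rfl⟩ := hx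
      obtain ⟨W, hW, rfl⟩ := hy
      exact ⟨Z + W, hZ.add hW, by simp⟩
    | smul a x _ hx =>
      obtain ⟨Z, hZ, rfl⟩ := hx
      exact ⟨a • Z, hZ.smul a, by simp⟩
  obtain ⟨Z, hZ, h1⟩ := hspan _ h
  rwa [Matrix.vec_inj.mp h1]

/-- The closed-loop matrix in the coordinates given by the factor `L` of `F`. -/
theorem conj_closedLoop {n : ℕ} {A F L X : Matrix (Fin n) (Fin n) ℝ} (hF : F = L * Lᵀ)
    (hL : IsUnit L.det) : L⁻¹ * closedLoop A F X * L = L⁻¹ * A * L - Lᵀ * X * L := by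
  rw [closedLoop, hF]
  simp only [mul_sub, sub_mul, Matrix.mul_assoc, Matrix.nonsing_inv_mul_cancel_left _ _ hL]

theorem posSemidef_congr {n : ℕ} {L X : Matrix (Fin n) (Fin n) ℝ} (hX : X.PosSemidef) :
    (Lᵀ * X * L).PosSemidef := by
  simpa using hX.conjTranspose_mul_mul_same L

theorem dissipative_conj_closedLoop {n : ℕ} {A F L X : Matrix (Fin n) (Fin n) ℝ}
    (hF : F = L * Lᵀ) (hL : IsUnit L.det) (hB : Dissipative (L⁻¹ * A * L)) (hX : X.PosSemidef) :
    Dissipative (L⁻¹ * closedLoop A F X * L) := by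
  rw [conj_closedLoop hF hL]
  exact hB.sub_posSemidef (posSemidef_congr hX)

theorem posSemidef_of_lyapunovResidual {n : ℕ} {A F Q L X Y : Matrix (Fin n) (Fin n) ℝ}
    (hF : F = L * Lᵀ) (hL : IsUnit L.det) (hB : Dissipative (L⁻¹ * A * L)) (hQ : Q.IsHermitian)
    (hX : X.PosSemidef) (hY : Y.IsSymm) (h : norm2 (lyapunovResidual A F Q X Y) ≤ lambdaMin Q) :
    Y.PosSemidef := by
  have hXs : Xᵀ = X := by simpa using hX.1.eq
  have hQs : Qᵀ = Q := by simpa using hQ.eq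
  have hYs : Yᵀ = Y := hY.eq
  have hXF : X * F * X = (Lᵀ * X)ᵀ * (Lᵀ * X) := by
    rw [hF]; simp [hXs, Matrix.mul_assoc]
  have hXFp : (X * F * X).PosSemidef := by
    rw [hXF]; simpa using Matrix.posSemidef_conjTranspose_mul_self (Lᵀ * X)
  have hR : (lyapunovResidual A F Q X Y).IsHermitian := by
    have h1 : (X * F * X)ᵀ = X * F * X := by simpa using hXFp.1.eq
    rw [Matrix.IsHermitian, conjTranspose_eq_transpose_of_trivial, lyapunovResidual,
      transpose_add, transpose_add, transpose_add, h1, hQs]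
    simp only [transpose_mul, transpose_transpose, hYs]
    abel
  -- With R the residual, Y solves the exact Lyapunov equation with right-hand side -(XFX + (Q -
  -- R)).
  have hP := hXFp.add (posSemidef_sub_of_norm2_le hQ hR h)
  have hC := dissipative_conj_closedLoop hF hL hB hX
  have hLt : IsUnit (Lᵀ).det := by rwa [det_transpose]
  have hY' : (Lᵀ * Y * L).PosSemidef := by
    refine hC.posSemidef_of_lyapunov (P := Lᵀ * (X * F * X + (Q - lyapunovResidual A F Q X Y)) * L)
      ?_ (posSemidef_congr hP) ?_
    · simp [Matrix.IsHermitian, hYs, Matrix.mul_assoc]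
    · have h1 : X * F * X + (Q - lyapunovResidual A F Q X Y) =
          -((closedLoop A F X)ᵀ * Y + Y * closedLoop A F X) := by
        rw [lyapunovResidual]; abel
      rw [h1, transpose_mul, transpose_mul]
      have h2 : (L⁻¹)ᵀ * Lᵀ = 1 := by
        rw [← transpose_mul, mul_nonsing_inv _ hL, transpose_one]
      have h3 : Lᵀ * ((closedLoop A F X)ᵀ * (L⁻¹)ᵀ) * (Lᵀ * Y * L) =
          Lᵀ * ((closedLoop A F X)ᵀ * ((L⁻¹)ᵀ * Lᵀ) * Y) * L := by
        simp only [Matrix.mul_assoc]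
      have h4 : Lᵀ * Y * L * (L⁻¹ * closedLoop A F X * L) =
          Lᵀ * (Y * (L * L⁻¹) * closedLoop A F X) * L := by
        simp only [Matrix.mul_assoc]
      rw [h3, h4, h2, mul_nonsing_inv _ hL]
      simp only [Matrix.mul_one, mul_neg, neg_mul, neg_neg, mul_add, add_mul]
  have h5 := posSemidef_congr (L := L⁻¹) hY'
  have h6 : (L⁻¹)ᵀ * (Lᵀ * Y * L) * L⁻¹ = ((L⁻¹)ᵀ * Lᵀ) * Y * (L * L⁻¹) := by
    simp only [Matrix.mul_assoc]
  rw [h6, ← transpose_mul, mul_nonsing_inv _ hL, transpose_one, Matrix.one_mul,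
    Matrix.mul_one] at h5
  exact h5

theorem IsRun.posSemidef {n : ℕ} {A F Q L X₀ : Matrix (Fin n) (Fin n) ℝ} {linesearch : Bool}
    {α : ℝ} {it s : ℕ → ℕ} {lam : ℕ → ℝ} {Xhat X : ℕ → Matrix (Fin n) (Fin n) ℝ}
    (hrun : IsRun A F Q X₀ linesearch α it s lam Xhat X)
    (hF : F = L * Lᵀ) (hL : IsUnit L.det) (hB : Dissipative (L⁻¹ * A * L)) (hQ : Q.IsHermitian)
    (hX₀ : X₀.PosSemidef)
    (hlyap : ∀ k, norm2 (lyapunovResidual A F Q (X k) (X (k + 1))) ≤ lambdaMin Q) (k : ℕ) :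
    (X k).PosSemidef := by
  induction k with
  | zero => rwa [hrun.init]
  | succ k ih =>
    refine posSemidef_of_lyapunovResidual hF hL hB hQ ih ?_ (hlyap k)
    have hXs : (X k)ᵀ = X k := by simpa using ih.1.eq
    have hQs : Qᵀ = Q := by simpa using hQ.eq
    have hsymm : (-(X k * F * X k + Q)).IsSymm := by
      simp [Matrix.IsSymm, hXs, hQs, hF, Matrix.mul_assoc]
    have hmem := (hrun.gmres k).1
    rw [← Matrix.vec_neg] at hmem
    have hhat : (Xhat (k + 1)).IsSymm := isSymm_of_mem_krylov hsymm hmem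
    rw [hrun.update]
    have hXk : (X k).IsSymm := hXs
    exact isSymm_bandTruncation _ ((hXk.smul _).add (hhat.smul _))

/-! ### Uniqueness, a priori bound and compactness -/

/-- R(X) - R(Y) is a Sylvester operator applied to X - Y, with the two closed loops as coefficients.
Only X has to be symmetric, so Y ranges over all real matrices. -/
theorem IsStabilizingSolution.eq {n : ℕ} {A F Q X Y : Matrix (Fin n) (Fin n) ℝ}
    (hF : F.IsSymm) (hXs : X.IsSymm) (hX : IsStabilizingSolution A F Q X)
    (hY : IsStabilizingSolution A F Q Y) : Y = X := by
  have hst : IsStable (closedLoop A F X)ᵀ := by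
    intro μ hμ
    apply hX.2
    rw [Matrix.mem_spectrum_iff_isRoot_charpoly, transpose_map, charpoly_transpose] at hμ
    rwa [Matrix.mem_spectrum_iff_isRoot_charpoly]
  refine (sub_eq_zero.mp (eq_zero_of_sylvester hst hY.2 (D := X - Y) ?_)).symm
  have h1 : (closedLoop A F X)ᵀ * (X - Y) + (X - Y) * closedLoop A F Y =
      riccati A F Q X - riccati A F Q Y := by
    simp only [closedLoop, riccati, transpose_sub, transpose_mul, hF.eq, hXs.eq]
    noncomm_ring
  rw [h1, hX.1, hY.1, sub_zero]

theorem trace_mul_nonneg_of_posSemidef {n : ℕ} {P Y : Matrix (Fin n) (Fin n) ℝ}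
    (hP : P.PosSemidef) (hY : Y.PosSemidef) : 0 ≤ (P * Y).trace := by
  obtain ⟨Z, rfl⟩ : ∃ Z : Matrix (Fin n) (Fin n) ℝ, Y = Zᴴ * Z := by
    open scoped MatrixOrder in
    exact CStarAlgebra.nonneg_iff_eq_star_mul_self.mp hY.nonneg
  rw [← Matrix.mul_assoc, trace_mul_comm, ← Matrix.mul_assoc]
  exact (hP.mul_mul_conjTranspose_same Z).trace_nonneg

/-- A priori bound on a positive semidefinite matrix in terms of its Riccati residual. -/
theorem sq_apply_le_trace {n : ℕ} {A F Q L X : Matrix (Fin n) (Fin n) ℝ}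
    (hF : F = L * Lᵀ) (hL : IsUnit L.det) (hB : Dissipative (L⁻¹ * A * L)) (hX : X.PosSemidef)
    (i j : Fin n) :
    (Lᵀ * X * L) i j ^ 2 ≤ (Lᵀ * (Q - riccati A F Q X) * L).trace := by
  have hY := posSemidef_congr (L := L) hX
  set Y := Lᵀ * X * L with hYdef
  set B := L⁻¹ * A * L with hBdef
  have hYs : Yᵀ = Y := by simpa using hY.1.eq
  have hP : (-(B + Bᵀ)).PosSemidef := by
    refine .of_dotProduct_mulVec_nonneg (by simp [Matrix.IsHermitian, add_comm]) fun x => ?_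
    have h1 : x ⬝ᵥ Bᵀ *ᵥ x = x ⬝ᵥ B *ᵥ x := by
      rw [mulVec_transpose, dotProduct_comm, ← dotProduct_mulVec]
    have h2 : x ⬝ᵥ B *ᵥ x ≤ 0 := by
      by_cases hx : x = 0
      · simp [hx]
      · exact (hB x hx).le
    rw [star_trivial, neg_mulVec, dotProduct_neg, add_mulVec, dotProduct_add, h1]
    linarith
  have h1 := trace_mul_nonneg_of_posSemidef hP hY
  -- The trace of BᵀY + YB is tr((B + Bᵀ)Y) ≤ 0, so the trace of this identity bounds the squared
  -- Frobenius norm of Y.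
  have h2 : Lᵀ * (Q - riccati A F Q X) * L = Yᵀ * Y - (Bᵀ * Y + Y * B) := by
    have hi : (L⁻¹)ᵀ * Lᵀ = 1 := by
      rw [← transpose_mul, mul_nonsing_inv _ hL, transpose_one]
    have e1 : Y * B = Lᵀ * (X * (L * L⁻¹) * A) * L := by
      simp only [hYdef, hBdef, Matrix.mul_assoc]
    have e2 : Bᵀ * Y = Lᵀ * (Aᵀ * ((L⁻¹)ᵀ * Lᵀ) * X) * L := by
      simp only [hYdef, hBdef, transpose_mul, Matrix.mul_assoc]
    have e3 : Yᵀ * Y = Lᵀ * (X * F * X) * L := by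
      rw [hYs]
      simp only [hYdef, hF, Matrix.mul_assoc]
    rw [e1, e2, e3, hi, mul_nonsing_inv _ hL, Matrix.mul_one, Matrix.mul_one, ← Matrix.add_mul,
      ← Matrix.mul_add, ← Matrix.sub_mul, ← Matrix.mul_sub, riccati]
    congr 2
    abel
  have h3 : (Y * B).trace = (B * Y).trace := trace_mul_comm _ _
  have h4 : Y i j ^ 2 ≤ (Yᵀ * Y).trace := by
    have : (Yᵀ * Y).trace = ∑ b, ∑ a, Y a b ^ 2 := by
      simp [Matrix.trace, Matrix.mul_apply, pow_two]
    rw [this]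
    calc Y i j ^ 2 ≤ ∑ a, Y a j ^ 2 :=
          Finset.single_le_sum (f := fun a => Y a j ^ 2) (fun a _ => sq_nonneg _)
            (Finset.mem_univ i)
      _ ≤ _ := Finset.single_le_sum (f := fun b => ∑ a, Y a b ^ 2)
            (fun b _ => Finset.sum_nonneg fun a _ => sq_nonneg _) (Finset.mem_univ j)
  rw [h2, trace_sub, trace_add, h3]
  rw [neg_mul, trace_neg, add_mul, trace_add] at h1
  linarith

theorem continuous_riccati {n : ℕ} (A F Q : Matrix (Fin n) (Fin n) ℝ) :
    Continuous (riccati A F Q) := by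
  unfold riccati
  fun_prop

theorem isClosed_posSemidef {n : ℕ} : IsClosed {X : Matrix (Fin n) (Fin n) ℝ | X.PosSemidef} := by
  simp only [Matrix.posSemidef_iff_dotProduct_mulVec, Set.ofPred_and, Set.ofPred_forall]
  refine IsClosed.inter ?_ (isClosed_iInter fun x => ?_)
  · exact isClosed_eq (by fun_prop) continuous_id
  · exact isClosed_le continuous_const (by fun_prop)

/-- On a kernel vector v of X, the form of R(X) reduces to vᵀQv > 0. -/
theorem posDef_of_riccati_eq_zero {n : ℕ} {A F Q X : Matrix (Fin n) (Fin n) ℝ}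
    (hQ : Q.PosDef) (hX : X.PosSemidef) (h : riccati A F Q X = 0) : X.PosDef := by
  refine hX.posDef_iff_isUnit.mpr ?_
  rw [Matrix.isUnit_iff_isUnit_det, isUnit_iff_ne_zero]
  intro hdet
  obtain ⟨v, hv, hXv⟩ := Matrix.exists_mulVec_eq_zero_iff.mpr hdet
  have hXs : Xᵀ = X := by simpa using hX.1.eq
  have hvX : v ᵥ* X = 0 := by rw [← mulVec_transpose, hXs, hXv]
  have h1 := congrArg (fun Z => v ⬝ᵥ Z *ᵥ v) h
  have h2 := hQ.dotProduct_mulVec_pos hv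
  rw [star_trivial] at h2
  simp only [riccati, add_mulVec, sub_mulVec, dotProduct_add, dotProduct_sub, ← mulVec_mulVec,
    hXv, mulVec_zero, dotProduct_zero, zero_mulVec] at h1
  rw [dotProduct_mulVec v X, hvX, zero_dotProduct] at h1
  linarith

theorem tendsto_zero_of_norm2 {n : ℕ} {R : ℕ → Matrix (Fin n) (Fin n) ℝ} {q : ℝ} (hq0 : 0 ≤ q)
    (hq1 : q < 1) (h : ∀ k, norm2 (R (k + 1)) ≤ q * norm2 (R k)) : Tendsto R atTop (𝓝 0) := by
  have hgeom : ∀ k, norm2 (R k) ≤ q ^ k * norm2 (R 0) := by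
    intro k
    induction k with
    | zero => simp
    | succ k ih =>
      calc norm2 (R (k + 1)) ≤ q * norm2 (R k) := h k
        _ ≤ q * (q ^ k * norm2 (R 0)) := mul_le_mul_of_nonneg_left ih hq0
        _ = _ := by ring
  have hlim : Tendsto (fun k => q ^ k * norm2 (R 0)) atTop (𝓝 0) := by
    simpa using (tendsto_pow_atTop_nhds_zero_of_lt_one hq0 hq1).mul_const (norm2 (R 0))
  refine tendsto_pi_nhds.mpr fun i => tendsto_pi_nhds.mpr fun j => ?_
  exact squeeze_zero_norm (fun k => (abs_apply_le_norm2 (R k) i j).trans (hgeom k)) hlim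

/-- Positive semidefinite matrices whose Riccati residuals tend to `0` stay in a compact set. -/
theorem exists_isCompact_of_tendsto {n : ℕ} {A F Q L : Matrix (Fin n) (Fin n) ℝ}
    {X : ℕ → Matrix (Fin n) (Fin n) ℝ}
    (hF : F = L * Lᵀ) (hL : IsUnit L.det) (hB : Dissipative (L⁻¹ * A * L))
    (hX : ∀ k, (X k).PosSemidef) (hR : Tendsto (fun k => riccati A F Q (X k)) atTop (𝓝 0)) :
    ∃ K : Set (Matrix (Fin n) (Fin n) ℝ), IsCompact K ∧ ∀ k, X k ∈ K := by
  have hcont : Continuous fun R : Matrix (Fin n) (Fin n) ℝ => (Lᵀ * (Q - R) * L).trace := by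
    fun_prop
  obtain ⟨c, hc⟩ := ((hcont.tendsto 0).comp hR).bddAbove_range
  have hcompact : IsCompact (Set.univ.pi fun _ : Fin n => Set.univ.pi fun _ : Fin n =>
      Set.Icc (-√c) √c) :=
    isCompact_univ_pi fun _ => isCompact_univ_pi fun _ => isCompact_Icc
  refine ⟨(fun Y : Matrix (Fin n) (Fin n) ℝ => (L⁻¹)ᵀ * Y * L⁻¹) '' _,
    hcompact.image (by fun_prop), fun k => ⟨Lᵀ * X k * L, ?_, ?_⟩⟩
  · intro i _ j _
    exact abs_le.mp (Real.abs_le_sqrt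
      ((sq_apply_le_trace hF hL hB (hX k) i j).trans (hc ⟨k, rfl⟩)))
  · have h6 : (L⁻¹)ᵀ * (Lᵀ * X k * L) * L⁻¹ = ((L⁻¹)ᵀ * Lᵀ) * X k * (L * L⁻¹) := by
      simp only [Matrix.mul_assoc]
    dsimp only
    rw [h6, ← transpose_mul, mul_nonsing_inv _ hL, transpose_one, Matrix.one_mul, Matrix.mul_one]

end TINK

/-! ### Convergence of the iteration -/

theorem corollary3p3 {n : ℕ} (A F Q L X₀ : Matrix (Fin n) (Fin n) ℝ)
    (hF : F.PosDef) (hL : F = L * Lᵀ) (hQ : Q.PosDef)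
    (hW : ∀ z ∈ TINK.numericalRange (L⁻¹ * A * L), z.re < 0)
    (hX₀ : X₀.PosSemidef) (hstab : TINK.IsStable (TINK.closedLoop A F X₀))
    (linesearch : Bool) (α : ℝ) (hα : 0 < α)
    (it s : ℕ → ℕ) (lam : ℕ → ℝ) (Xhat X : ℕ → Matrix (Fin n) (Fin n) ℝ)
    (hrun : TINK.IsRun A F Q X₀ linesearch α it s lam Xhat X)
    (lamBar : ℝ) (hlamBar : 0 < lamBar) (hlam : ∀ k, lamBar ≤ lam k)
    (ζ : ℝ) (hζ0 : 0 < ζ) (hζ1 : ζ < 1)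
    (hcare : ∀ k, TINK.norm2 (TINK.riccati A F Q
        (TINK.bandTruncation (s k) ((1 - lam k) • X k + lam k • Xhat (k + 1)))) ≤
      (1 - ζ) * TINK.norm2 (TINK.riccati A F Q (X k)))
    (hlyap : ∀ k, TINK.norm2 (TINK.lyapunovResidual A F Q (X k)
        (TINK.bandTruncation (s k) ((1 - lam k) • X k + lam k • Xhat (k + 1)))) ≤
      TINK.lambdaMin Q) :
    ∃ Xstar : Matrix (Fin n) (Fin n) ℝ,
      Xstar.PosDef ∧ TINK.IsStabilizingSolution A F Q Xstar ∧
      (∀ Y : Matrix (Fin n) (Fin n) ℝ, TINK.IsStabilizingSolution A F Q Y → Y = Xstar) ∧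
      Tendsto X atTop (𝓝 Xstar) := by
  have hLdet : IsUnit L.det := by
    have h1 := hF.det_pos
    rw [hL, det_mul, det_transpose] at h1
    exact isUnit_iff_ne_zero.mpr fun h0 => by simp [h0] at h1
  have hB := TINK.dissipative_of_numericalRange hW
  simp only [← hrun.update] at hcare hlyap
  have hX := hrun.posSemidef hL hLdet hB hQ.1 hX₀ hlyap
  have hR : Tendsto (fun k => TINK.riccati A F Q (X k)) atTop (𝓝 0) :=
    TINK.tendsto_zero_of_norm2 (sub_nonneg.mpr hζ1.le) (by linarith) hcare
  obtain ⟨K, hK, hXK⟩ := TINK.exists_isCompact_of_tendsto hL hLdet hB hX hR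
  -- Stability alone could be lost in the limit; it is recovered from positive semidefiniteness, a
  -- closed condition.
  have hclust : ∀ Z, MapClusterPt Z atTop X →
      Z.PosSemidef ∧ TINK.IsStabilizingSolution A F Q Z := by
    intro Z hZ
    have hpsd : Z.PosSemidef :=
      TINK.isClosed_posSemidef.mem_of_mapClusterPt hZ (Eventually.of_forall hX)
    have h1 : MapClusterPt (TINK.riccati A F Q Z) atTop (TINK.riccati A F Q ∘ X) :=
      hZ.continuousAt_comp (TINK.continuous_riccati A F Q).continuousAt
    have h2 : (𝓝 (TINK.riccati A F Q Z) ⊓ 𝓝 0).NeBot := NeBot.mono h1 (inf_le_inf_left _ hR)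
    exact ⟨hpsd, eq_of_nhds_neBot h2,
      TINK.isStable_conj hLdet (TINK.dissipative_conj_closedLoop hL hLdet hB hpsd).isStable⟩
  obtain ⟨Xstar, -, hstar⟩ := hK.exists_mapClusterPt (f := atTop) (u := X)
    (le_principal_iff.mpr (mem_map.mpr (Eventually.of_forall hXK)))
  obtain ⟨hpsd, hsol⟩ := hclust Xstar hstar
  have hFs : F.IsSymm :=
    (conjTranspose_eq_transpose_of_trivial F).symm.trans hF.1.eq
  have hXs : Xstar.IsSymm :=
    (conjTranspose_eq_transpose_of_trivial Xstar).symm.trans hpsd.1.eq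
  have huniq : ∀ Y, TINK.IsStabilizingSolution A F Q Y → Y = Xstar := fun Y hY =>
    TINK.IsStabilizingSolution.eq hFs hXs hsol hY
  exact ⟨Xstar, TINK.posDef_of_riccati_eq_zero hQ hpsd hsol.1, hsol, huniq,
    hK.tendsto_nhds_of_unique_mapClusterPt (Eventually.of_forall hXK)
      fun Z _ hZ => huniq Z (hclust Z hZ).2⟩
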